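/- Let $(X,d)$ be a proper metric space (closed balls are compact) that is unbounded, let $N\ge 2$, and let $\lambda=(\lambda_1,\dots,\lambda_N)$ satisfy $\lambda_i\ge 0$ and $\sum_{i=1}^N\lambda_i=1$. Let $\mathcal P_1(X)$ be the set of Borel probability measures $\mu$ on $X$ with $\int_X d(x_0,x)\,d\mu(x)<\infty$ for some $x_0\in X$, equipped with the Wasserstein distance $$W_1(\mu,\nu)=\inf_{\gamma}\int_{X\times X}d(x,y)\,d\gamma(x,y),$$ where $\gamma$ ranges over the Borel probability measures on $X\times X$ with marginals $\mu$ and $\nu$. For $\nu=(\nu_1,\dots,\nu_N)\in\mathcal P_1(X)^N$ let $$\mathrm{Med}_\lambda(\nu)=\operatorname*{argmin}_{\mu\in\mathcal P_1(X)}\ \sum_{i=1}^N\lambda_i W_1(\nu_i,\mu)$$ be the set of Wasserstein medians of $\nu$ with weights $\lambda$. The break-down point of $\mathrm{Med}_\lambda$ at $\nu$ is $$b(\mathrm{Med}_\lambda(\nu))=\min\Big\{\sum_{i\in I}\lambda_i\ :\ I\subset\{1,\dots,N\},\ \sup\big\{W_1(\rho',\rho)\,:\,\rho'\in\mathrm{Med}_\lambda(\mu),\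 \rho\in\mathrm{Med}_\lambda(\nu),\ \mu\in\mathcal P_1(X)^N,\ \mu_j=\nu_j\ \forall j\notin I\big\}=+\infty\Big\}.$$ Theorem (Break-down point of Wasserstein medians). For every $\nu\in\mathcal P_1(X)^N$ the set $\mathrm{Med}_\lambda(\nu)$ is nonempty, the minimum defining the break-down point is attained, and $$b(\mathrm{Med}_\lambda(\nu))=\min\Big\{\sum_{j\in J}\lambda_j\ :\ J\subset\{1,\dots,N\},\ \sum_{j\in J}\lambda_j\ge\tfrac12\Big\}.$$ In particular, for uniform weights $\lambda_i=1/N$ one has $b(\mathrm{Med}_\lambda(\nu))=\lfloor (N+1)/2\rfloor/N$. -/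

import Mathlib

open MeasureTheory
open scoped ENNReal

namespace WassersteinMedian

section Wasserstein

variable {X : Type*} [MetricSpace X] [MeasurableSpace X]

/-- Transport plans between `μ` and `ν`: probability measures on `X × X` with marginals `μ`
and `ν`. -/
def transportPlans (μ ν : ProbabilityMeasure X) : Set (ProbabilityMeasure (X × X)) :=
  {γ | (γ : Measure (X × X)).fst = (μ : Measure X) ∧ (γ : Measure (X × X)).snd = (ν : Measure X)}

/-- The Kantorovich cost `inf_{γ ∈ Π(μ,ν)} ∫ d(x,y) dγ(x,y)`, with values in `[0, ∞]`. -/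
noncomputable def transportCost (μ ν : ProbabilityMeasure X) : ℝ≥0∞ :=
  ⨅ γ ∈ transportPlans μ ν, ∫⁻ p : X × X, edist p.1 p.2 ∂(γ : Measure (X × X))

variable (X) in
/-- `P₁(X)`: the probability measures `μ` on `X` with `d(x₀, ·) ∈ L¹(X, μ)` for some `x₀`. -/
def P1 : Type _ :=
  {μ : ProbabilityMeasure X // ∃ x₀ : X, Integrable (fun x => dist x₀ x) (μ : Measure X)}

/-- The Wasserstein distance of order one on `P₁(X)`. The cost is finite there
(`transportCost_lt_top`), so `toReal` loses nothing. -/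
noncomputable def W1 (μ ν : P1 X) : ℝ :=
  (transportCost μ.1 ν.1).toReal

/-- `P₁(X)` carries the distance `W₁`. -/
noncomputable instance : Dist (P1 X) := ⟨W1⟩

theorem transportCost_lt_top [ProperSpace X] [BorelSpace X] (μ ν : P1 X) :
    transportCost μ.1 ν.1 < ∞ := by
  obtain ⟨μ, a, ha⟩ := μ
  obtain ⟨ν, b, hb⟩ := ν
  have hmem : μ.prod ν ∈ transportPlans μ ν := by
    constructor <;> simp
  refine lt_of_le_of_lt (iInf₂_le (μ.prod ν) hmem) ?_
  have h1 : Integrable (fun p : X × X => dist a p.1) ((μ : Measure X).prod (ν : Measure X)) :=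
    ha.comp_fst _
  have h2 : Integrable (fun p : X × X => dist b p.2) ((μ : Measure X).prod (ν : Measure X)) :=
    hb.comp_snd _
  have h3 : Integrable (fun p : X × X => dist p.1 p.2)
      ((μ : Measure X).prod (ν : Measure X)) := by
    refine ((h1.add (integrable_const (dist a b))).add h2).mono'
      (by fun_prop) (Filter.Eventually.of_forall fun p => ?_)
    rw [Real.norm_of_nonneg dist_nonneg]
    have := dist_triangle4 p.1 a b p.2
    rw [dist_comm p.1 a] at this
    exact this
  have h4 := h3.lintegral_lt_top
  simpa [edist_dist] using h4

variable {N : ℕ}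

/-- The weighted dispersion functional `μ ↦ ∑ᵢ wᵢ W₁(νᵢ, μ)` on `P₁(X)`. -/
noncomputable def dispersion (w : Fin N → ℝ) (ν : Fin N → P1 X) (μ : P1 X) : ℝ :=
  ∑ i, w i * W1 (ν i) μ

/-- The set of Wasserstein medians of `ν` with weights `w`: the minimizers of the dispersion
functional over `P₁(X)`. -/
def Med (w : Fin N → ℝ) (ν : Fin N → P1 X) : Set (P1 X) :=
  {μ | ∀ ρ : P1 X, dispersion w ν μ ≤ dispersion w ν ρ}

end Wasserstein

section Breakdown

variable {M : Type*} [Dist M] {N : ℕ}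

/-- The largest displacement `sup d(y, x)`, over `y ∈ t(z)` and `x ∈ t(x₁, …, x_N)`, where `z`
ranges over all samples obtained from `(x₁, …, x_N)` by changing only entries with index in `I`.
The supremum is taken in `[-∞, ∞]`. -/
noncomputable def maxDisplacement (t : (Fin N → M) → Set M) (x : Fin N → M)
    (I : Finset (Fin N)) : EReal :=
  sSup {r : EReal | ∃ z : Fin N → M, (∀ j, j ∉ I → z j = x j) ∧
    ∃ y ∈ t z, ∃ y₀ ∈ t x, r = ((dist y y₀ : ℝ) : EReal)}

/-- The total weights of the index sets whose corruption can move the estimator arbitrarily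
far. -/
def breakdownWeights (w : Fin N → ℝ) (t : (Fin N → M) → Set M) (x : Fin N → M) : Set ℝ :=
  {r | ∃ I : Finset (Fin N), maxDisplacement t x I = ⊤ ∧ r = ∑ i ∈ I, w i}

/-- The break-down point at the sample `x` of the set-valued estimator `t`, for the weights `w`:
the minimum of `breakdownWeights w t x`. This is a finite set, so the infimum is a minimum as soon
as the set is nonempty. -/
noncomputable def breakdownPoint (w : Fin N → ℝ) (t : (Fin N → M) → Set M) (x : Fin N → M) : ℝ :=
  sInf (breakdownWeights w t x)

end Breakdown

end WassersteinMedian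

/-!
The proof rests on `W₁` being a finite distance on `P₁(X)` for which medians exist.

*The distance.* The triangle inequality for the transport cost is the gluing construction: two plans
sharing the marginal `μ₂` are disintegrated over it, and the product of the two conditional kernels
couples the outer marginals (`transportCost_triangle`). A Dirac mass has only one plan to any
other measure, so `transportCost (δ a) ρ = ∫ d(a, y) dρ(y)` (`transportCost_dirac`).

*Existence of medians* (`Med_nonempty`). Instead of minimizing over `μ`, one minimizes
`∑ᵢ wᵢ ∫ d dγᵢ` over tuples of plans `γᵢ` whose first marginals are the `νᵢ` and whose second
marginals all agree. This functional is lower semicontinuous for weak convergence, and restricting to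
plans with first moment at most `C` makes the domain compact: in a proper space, balls are compact,
so Markov's inequality gives tightness, and Prokhorov's theorem applies
(`isCompact_setOf_lintegral_edist_le`). For `C` large, near-optimal plans to every competitor
that is not worse than a fixed one lie in this domain.

*The break-down point.* If the corrupted weight `c = ∑_{i ∈ I} wᵢ` is below one half, comparing a
corrupted median `m` with a median `ρ` of `ν` gives `(1 - 2c) W₁(m, ρ) ≤ 2 ∑ᵢ wᵢ W₁(νᵢ, ρ)`
(`one_sub_two_mul_W1_le`). If `c ≥ 1/2`, moving all the corrupted entries to a single Dirac
mass `δ x` makes `δ x` a median (`mem_Med_of_half_le`), and `x` can be taken arbitrarily far away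
as `X` is unbounded. Hence the sets `I` that cause break-down are exactly those of weight at least
one half (`maxDisplacement_Med_eq_top_iff`).
-/

open ProbabilityTheory

namespace WassersteinMedian

section Distance

/-! ### The transport cost -/

theorem lintegral_fst_of_mem_transportPlans {X : Type*} [MeasurableSpace X]
    {μ ν : ProbabilityMeasure X}
    {γ : ProbabilityMeasure (X × X)} (hγ : γ ∈ transportPlans μ ν) {f : X → ℝ≥0∞}
    (hf : Measurable f) :
    ∫⁻ p : X × X, f p.1 ∂(γ : Measure (X × X)) = ∫⁻ x, f x ∂(μ : Measure X) := by
  rw [← hγ.1, Measure.fst, lintegral_map hf measurable_fst]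

theorem lintegral_snd_of_mem_transportPlans {X : Type*} [MeasurableSpace X]
    {μ ν : ProbabilityMeasure X}
    {γ : ProbabilityMeasure (X × X)} (hγ : γ ∈ transportPlans μ ν) {f : X → ℝ≥0∞}
    (hf : Measurable f) :
    ∫⁻ p : X × X, f p.2 ∂(γ : Measure (X × X)) = ∫⁻ y, f y ∂(ν : Measure X) := by
  rw [← hγ.2, Measure.snd, lintegral_map hf measurable_snd]

variable {X : Type*} [MetricSpace X] [MeasurableSpace X]

theorem transportCost_le {μ ν : ProbabilityMeasure X} {γ : ProbabilityMeasure (X × X)}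
    (hγ : γ ∈ transportPlans μ ν) :
    transportCost μ ν ≤ ∫⁻ p : X × X, edist p.1 p.2 ∂(γ : Measure (X × X)) :=
  iInf₂_le γ hγ

theorem exists_mem_transportPlans_lintegral_lt {μ ν : ProbabilityMeasure X} {c : ℝ≥0∞}
    (h : transportCost μ ν < c) :
    ∃ γ ∈ transportPlans μ ν, ∫⁻ p : X × X, edist p.1 p.2 ∂(γ : Measure (X × X)) < c := by
  simpa only [transportCost, iInf_lt_iff, exists_prop] using h

theorem W1_nonneg (μ ν : P1 X) : 0 ≤ W1 μ ν := ENNReal.toReal_nonneg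

variable [ProperSpace X] [BorelSpace X]

theorem transportCost_comm_le (μ ν : ProbabilityMeasure X) :
    transportCost μ ν ≤ transportCost ν μ := by
  refine le_iInf₂ fun γ hγ => ?_
  have hmem : γ.map (f := Prod.swap) measurable_swap.aemeasurable ∈ transportPlans μ ν := by
    constructor
    · rw [ProbabilityMeasure.toMeasure_map, Measure.fst_map_swap, hγ.2]
    · rw [ProbabilityMeasure.toMeasure_map, Measure.snd_map_swap, hγ.1]
  refine (transportCost_le hmem).trans_eq ?_
  rw [ProbabilityMeasure.toMeasure_map, lintegral_map (by fun_prop) measurable_swap]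
  simp only [Prod.fst_swap, Prod.snd_swap, edist_comm]

theorem transportCost_comm (μ ν : ProbabilityMeasure X) :
    transportCost μ ν = transportCost ν μ :=
  le_antisymm (transportCost_comm_le μ ν) (transportCost_comm_le ν μ)

/-- Gluing: two plans sharing a marginal are the two-dimensional marginals of a measure on
`X × (X × X)`, whose first coordinate carries the shared marginal. -/
theorem exists_glued {μ₁ μ₂ μ₃ : ProbabilityMeasure X} {γ γ' : ProbabilityMeasure (X × X)}
    (hγ : γ ∈ transportPlans μ₂ μ₁) (hγ' : γ' ∈ transportPlans μ₂ μ₃) :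
    ∃ π : Measure (X × (X × X)),
      π.map (Prod.map id Prod.fst) = γ ∧ π.map (Prod.map id Prod.snd) = γ' := by
  have : Nonempty X := μ₁.nonempty
  refine ⟨(μ₂ : Measure X) ⊗ₘ
    ((γ : Measure (X × X)).condKernel ×ₖ (γ' : Measure (X × X)).condKernel), ?_, ?_⟩
  · rw [← Measure.compProd_map measurable_fst, ← Kernel.fst_eq, Kernel.fst_prod, ← hγ.1,
      Measure.disintegrate]
  · rw [← Measure.compProd_map measurable_snd, ← Kernel.snd_eq, Kernel.snd_prod, ← hγ'.1,
      Measure.disintegrate]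

theorem transportCost_triangle (μ₁ μ₂ μ₃ : ProbabilityMeasure X) :
    transportCost μ₁ μ₃ ≤ transportCost μ₁ μ₂ + transportCost μ₂ μ₃ := by
  rw [transportCost_comm μ₁ μ₂]
  simp only [transportCost, ENNReal.iInf_add, ENNReal.add_iInf]
  refine le_iInf₂ fun γ' hγ' => le_iInf₂ fun γ hγ => ?_
  obtain ⟨π, h1, h2⟩ := exists_glued hγ hγ'
  have m1 : Measurable (Prod.map id Prod.fst : X × (X × X) → X × X) := by fun_prop
  have m2 : Measurable (Prod.map id Prod.snd : X × (X × X) → X × X) := by fun_prop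
  have hfst : π.snd.fst = (μ₁ : Measure X) := by
    rw [← hγ.2, ← h1, Measure.snd, Measure.fst, Measure.snd, Measure.map_map measurable_fst
      measurable_snd, Measure.map_map measurable_snd m1]
    rfl
  have hsnd : π.snd.snd = (μ₃ : Measure X) := by
    rw [← hγ'.2, ← h2, Measure.snd, Measure.snd, Measure.snd, Measure.map_map measurable_snd
      measurable_snd, Measure.map_map measurable_snd m2]
    rfl
  have hprob : IsProbabilityMeasure π.snd := by
    constructor
    rw [← Measure.fst_univ, hfst]
    exact measure_univ
  refine (transportCost_le (γ := ⟨π.snd, hprob⟩) ⟨hfst, hsnd⟩).trans ?_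
  rw [← h1, ← h2, lintegral_map (by fun_prop) m1, lintegral_map (by fun_prop) m2,
    ← lintegral_add_left (by fun_prop)]
  simp only [ProbabilityMeasure.coe_mk, Measure.snd]
  rw [lintegral_map (by fun_prop) measurable_snd]
  refine lintegral_mono fun q => ?_
  simp only [Prod.map_fst, Prod.map_snd, id]
  rw [edist_comm q.1 q.2.1]
  exact edist_triangle _ _ _

/-- The Dirac mass at `a` as a point of the space of probability measures. -/
noncomputable def diracProb (a : X) : ProbabilityMeasure X := ⟨Measure.dirac a, inferInstance⟩

theorem transportCost_dirac (a : X) (ρ : ProbabilityMeasure X) :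
    transportCost (diracProb a) ρ = ∫⁻ y, edist a y ∂(ρ : Measure X) := by
  have key : ∀ γ ∈ transportPlans (diracProb a) ρ,
      ∫⁻ p : X × X, edist p.1 p.2 ∂(γ : Measure (X × X)) = ∫⁻ y, edist a y ∂(ρ : Measure X) := by
    intro γ hγ
    have hae : ∀ᵐ p : X × X ∂(γ : Measure (X × X)), p.1 = a := by
      refine ae_of_ae_map (f := Prod.fst) (p := fun x => x = a) measurable_fst.aemeasurable ?_
      have h1 := hγ.1
      rw [Measure.fst] at h1
      rw [h1]
      change ∀ᵐ x ∂(Measure.dirac a), x = a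
      rw [ae_dirac_eq]
      rfl
    rw [← lintegral_snd_of_mem_transportPlans hγ (f := fun y => edist a y) (by fun_prop)]
    refine lintegral_congr_ae ?_
    filter_upwards [hae] with p hp
    rw [hp]
  have hmem : (diracProb a).prod ρ ∈ transportPlans (diracProb a) ρ := by
    constructor <;> simp
  exact le_antisymm ((transportCost_le hmem).trans_eq (key _ hmem))
    (le_iInf₂ fun γ hγ => (key γ hγ).ge)

theorem lintegral_edist_le_add_transportCost (a : X) (ν ρ : ProbabilityMeasure X) :
    ∫⁻ x, edist a x ∂(ρ : Measure X) ≤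
      ∫⁻ x, edist a x ∂(ν : Measure X) + transportCost ν ρ := by
  rw [← transportCost_dirac, ← transportCost_dirac]
  exact transportCost_triangle _ _ _

/-! ### The distance on `P₁(X)` -/

theorem lintegral_edist_lt_top (μ : P1 X) (a : X) :
    ∫⁻ x, edist a x ∂(μ.1 : Measure X) < ∞ := by
  obtain ⟨μ, b, hb⟩ := μ
  have h : Integrable (fun x => dist a x) (μ : Measure X) := by
    refine ((integrable_const (dist a b)).add hb).mono' (by fun_prop)
      (Filter.Eventually.of_forall fun x => ?_)
    rw [Real.norm_of_nonneg dist_nonneg]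
    exact dist_triangle a b x
  simpa [edist_dist] using h.lintegral_lt_top

/-- A probability measure with finite first moment, as a point of `P₁(X)`. -/
def P1.ofLintegral (μ : ProbabilityMeasure X) (a : X)
    (h : ∫⁻ x, edist a x ∂(μ : Measure X) < ∞) : P1 X :=
  ⟨μ, a, by
    refine ⟨by fun_prop, ?_⟩
    rw [hasFiniteIntegral_iff_norm]
    simpa [Real.norm_of_nonneg, edist_dist] using h⟩

/-- The Dirac mass at `a` as a point of `P₁(X)`. -/
noncomputable def P1.dirac (a : X) : P1 X :=
  P1.ofLintegral (diracProb a) a (by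
    change ∫⁻ x, edist a x ∂(Measure.dirac a) < ∞
    rw [lintegral_dirac' _ (by fun_prop)]
    simp)

theorem ofReal_W1 (μ ν : P1 X) : ENNReal.ofReal (W1 μ ν) = transportCost μ.1 ν.1 :=
  ENNReal.ofReal_toReal (transportCost_lt_top μ ν).ne

theorem W1_comm (μ ν : P1 X) : W1 μ ν = W1 ν μ := by
  rw [W1, W1, transportCost_comm]

theorem W1_triangle (μ₁ μ₂ μ₃ : P1 X) : W1 μ₁ μ₃ ≤ W1 μ₁ μ₂ + W1 μ₂ μ₃ := by
  rw [W1, W1, W1, ← ENNReal.toReal_add (transportCost_lt_top _ _).ne (transportCost_lt_top _ _).ne]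
  exact ENNReal.toReal_mono
    (ENNReal.add_ne_top.2 ⟨(transportCost_lt_top _ _).ne, (transportCost_lt_top _ _).ne⟩)
    (transportCost_triangle _ _ _)

theorem W1_dirac_dirac (a b : X) : W1 (P1.dirac a) (P1.dirac b) = dist a b := by
  change (transportCost (diracProb a) (diracProb b)).toReal = _
  rw [transportCost_dirac]
  change (∫⁻ y, edist a y ∂(Measure.dirac b)).toReal = _
  rw [lintegral_dirac' _ (by fun_prop), edist_dist, ENNReal.toReal_ofReal dist_nonneg]

end Distance

section Compactness

/-! ### Weak compactness of sets with bounded first moment -/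

/-- The integral of a nonnegative continuous function is lower semicontinuous for weak convergence,
being the supremum of the integrals of its truncations. -/
theorem lowerSemicontinuous_lintegral {Y : Type*} [TopologicalSpace Y] [MeasurableSpace Y]
    [OpensMeasurableSpace Y] {f : Y → NNReal} (hf : Continuous f) :
    LowerSemicontinuous fun μ : ProbabilityMeasure Y => ∫⁻ y, f y ∂(μ : Measure Y) := by
  let g : ℕ → BoundedContinuousFunction Y NNReal := fun n =>
    BoundedContinuousFunction.mkOfBound ⟨fun y => min (f y) n, by fun_prop⟩ n fun x y => by
      have hx : min (f x) (n : NNReal) ≤ n := min_le_right _ _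
      have hy : min (f y) (n : NNReal) ≤ n := min_le_right _ _
      have hx' : ((min (f x) n : NNReal) : ℝ) ≤ n := by exact_mod_cast hx
      have hy' : ((min (f y) n : NNReal) : ℝ) ≤ n := by exact_mod_cast hy
      change dist (min (f x) (n : NNReal)) (min (f y) (n : NNReal)) ≤ n
      rw [NNReal.dist_eq, abs_le]
      have h1 := (min (f x) (n : NNReal)).coe_nonneg
      have h2 := (min (f y) (n : NNReal)).coe_nonneg
      constructor <;> linarith
  have hg : ∀ n y, g n y = min (f y) n := fun _ _ => rfl
  have hmono : Monotone fun n y => ((g n y : NNReal) : ℝ≥0∞) := by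
    intro m n hmn y
    simp only [hg]
    gcongr
  have heq : (fun μ : ProbabilityMeasure Y => ∫⁻ y, f y ∂(μ : Measure Y)) =
      fun μ : ProbabilityMeasure Y => ⨆ n, ∫⁻ y, g n y ∂(μ : Measure Y) := by
    ext μ
    rw [← lintegral_iSup (fun n => by fun_prop) hmono]
    refine lintegral_congr fun y => le_antisymm ?_ (iSup_le fun n => ?_)
    · obtain ⟨n, hn⟩ := exists_nat_ge (f y)
      refine le_iSup_of_le n ?_
      rw [hg, min_eq_left hn]
    · rw [hg]
      exact_mod_cast min_le_left _ _
  rw [heq]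
  exact lowerSemicontinuous_iSup fun n =>
    (ProbabilityMeasure.continuous_lintegral_boundedContinuousFunction (g n)).lowerSemicontinuous

theorem lowerSemicontinuous_lintegral_edist {Y Z : Type*} [TopologicalSpace Y] [MeasurableSpace Y]
    [OpensMeasurableSpace Y] [PseudoMetricSpace Z] {u v : Y → Z} (hu : Continuous u)
    (hv : Continuous v) :
    LowerSemicontinuous fun μ : ProbabilityMeasure Y => ∫⁻ y, edist (u y) (v y) ∂(μ : Measure Y) := by
  simp only [edist_nndist]
  exact lowerSemicontinuous_lintegral (hu.nndist hv)

theorem isCompact_setOf_lintegral_edist_le {Y : Type*} [MetricSpace Y] [ProperSpace Y]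
    [MeasurableSpace Y] [BorelSpace Y] (a : Y) {C : ℝ≥0∞} (hC : C ≠ ∞) :
    IsCompact {μ : ProbabilityMeasure Y | ∫⁻ x, edist a x ∂(μ : Measure Y) ≤ C} := by
  have hclosed : IsClosed {μ : ProbabilityMeasure Y | ∫⁻ x, edist a x ∂(μ : Measure Y) ≤ C} :=
    (lowerSemicontinuous_lintegral_edist (continuous_const (y := a))
      continuous_id).isClosed_preimage C
  rw [← hclosed.closure_eq]
  refine isCompact_closure_of_isTightMeasureSet
    (isTightMeasureSet_iff_exists_isCompact_measure_compl_le.2 fun ε hε => ?_)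
  obtain ⟨n, hn⟩ := ENNReal.exists_nat_gt (ENNReal.div_ne_top hC hε.ne')
  have hn0 : (n : ℝ≥0∞) ≠ 0 := (zero_le.trans_lt hn).ne'
  refine ⟨Metric.closedBall a n, isCompact_closedBall a n, ?_⟩
  rintro _ ⟨μ, hμ, rfl⟩
  -- Markov's inequality, the radius being chosen such that `C / n ≤ ε`
  calc (μ : Measure Y) (Metric.closedBall a n)ᶜ
      ≤ (μ : Measure Y) {x | (n : ℝ≥0∞) ≤ edist a x} := by
        refine measure_mono fun x hx => ?_
        simp only [Set.mem_compl_iff, Metric.mem_closedBall, not_le] at hx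
        rw [Set.mem_ofPred_eq, edist_comm, edist_dist, ← ENNReal.ofReal_natCast]
        exact ENNReal.ofReal_le_ofReal hx.le
    _ ≤ (∫⁻ x, edist a x ∂(μ : Measure Y)) / n :=
        meas_ge_le_lintegral_div (by fun_prop) hn0 (ENNReal.natCast_ne_top n)
    _ ≤ C / n := ENNReal.div_le_div_right hμ _
    _ ≤ ε := by
        refine ENNReal.div_le_of_le_mul ?_
        rw [mul_comm]
        rw [ENNReal.div_lt_iff (Or.inl hε.ne') (Or.inr hC)] at hn
        exact hn.le

end Compactness

section Existence

/-! ### Existence of medians -/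

variable {X : Type*} [MetricSpace X] [ProperSpace X] [MeasurableSpace X] [BorelSpace X] {N : ℕ}

theorem ofReal_dispersion {w : Fin N → ℝ} (hw : ∀ i, 0 ≤ w i) (ν : Fin N → P1 X) (μ : P1 X) :
    ENNReal.ofReal (dispersion w ν μ) =
      ∑ i, ENNReal.ofReal (w i) * transportCost (ν i).1 μ.1 := by
  rw [dispersion, ENNReal.ofReal_sum_of_nonneg fun i _ => mul_nonneg (hw i) (W1_nonneg _ _)]
  simp only [ENNReal.ofReal_mul (hw _), ofReal_W1]

/-- The total cost `∑ᵢ wᵢ ∫ d dγᵢ` attains its minimum over the tuples of plans of bounded first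
moment which lead from the `νᵢ` to a common measure. -/
theorem exists_minimal_plans (w : Fin N → ℝ) (ν : Fin N → P1 X) (a : X) {C : ℝ≥0∞}
    (hC : C ≠ ∞) (i₀ : Fin N) {γ₀ : Fin N → ProbabilityMeasure (X × X)} {ρ₀ : ProbabilityMeasure X}
    (hγ₀ : ∀ i, γ₀ i ∈ transportPlans (ν i).1 ρ₀)
    (hC₀ : ∀ i, ∫⁻ p, edist (a, a) p ∂(γ₀ i : Measure (X × X)) ≤ C) :
    ∃ μ : P1 X, ∀ (ρ : ProbabilityMeasure X) (γ : Fin N → ProbabilityMeasure (X × X)),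
      (∀ i, γ i ∈ transportPlans (ν i).1 ρ) →
      (∀ i, ∫⁻ p, edist (a, a) p ∂(γ i : Measure (X × X)) ≤ C) →
      ∑ i, ENNReal.ofReal (w i) * transportCost (ν i).1 μ.1 ≤
        ∑ i, ENNReal.ofReal (w i) * ∫⁻ p : X × X, edist p.1 p.2 ∂(γ i : Measure (X × X)) := by
  let fstP : ProbabilityMeasure (X × X) → ProbabilityMeasure X := fun γ =>
    γ.map (f := Prod.fst) measurable_fst.aemeasurable
  let sndP : ProbabilityMeasure (X × X) → ProbabilityMeasure X := fun γ =>
    γ.map (f := Prod.snd) measurable_snd.aemeasurable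
  have hfstP : Continuous fstP := ProbabilityMeasure.continuous_map continuous_fst
  have hsndP : Continuous sndP := ProbabilityMeasure.continuous_map continuous_snd
  let B : Set (Fin N → ProbabilityMeasure (X × X)) := Set.univ.pi fun _ =>
    {γ | ∫⁻ p, edist (a, a) p ∂(γ : Measure (X × X)) ≤ C}
  let S : Set (Fin N → ProbabilityMeasure (X × X)) :=
    {γ | ∀ i, fstP (γ i) = (ν i).1 ∧ sndP (γ i) = sndP (γ i₀)}
  have hB : IsCompact B := isCompact_univ_pi fun _ => isCompact_setOf_lintegral_edist_le (a, a) hC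
  have hS : IsClosed S := by
    have : S = ⋂ i, {γ | fstP (γ i) = (ν i).1 ∧ sndP (γ i) = sndP (γ i₀)} := by
      ext γ
      simp [S]
    rw [this]
    exact isClosed_iInter fun i =>
      (isClosed_eq (hfstP.comp (continuous_apply i)) continuous_const).inter
        (isClosed_eq (hsndP.comp (continuous_apply i)) (hsndP.comp (continuous_apply i₀)))
  have hmem : ∀ (ρ : ProbabilityMeasure X) (γ : Fin N → ProbabilityMeasure (X × X)),
      (∀ i, γ i ∈ transportPlans (ν i).1 ρ) →
      (∀ i, ∫⁻ p, edist (a, a) p ∂(γ i : Measure (X × X)) ≤ C) → γ ∈ B ∩ S := by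
    intro ρ γ hγ hγC
    refine ⟨fun i _ => hγC i, fun i => ⟨Subtype.ext (hγ i).1, Subtype.ext ?_⟩⟩
    exact (hγ i).2.trans (hγ i₀).2.symm
  have hlsc : LowerSemicontinuous fun γ : Fin N → ProbabilityMeasure (X × X) =>
      ∑ i, ENNReal.ofReal (w i) * ∫⁻ p : X × X, edist p.1 p.2 ∂(γ i : Measure (X × X)) := by
    refine lowerSemicontinuous_sum fun i _ => ?_
    exact (ENNReal.continuous_const_mul ENNReal.ofReal_ne_top).comp_lowerSemicontinuous
      ((lowerSemicontinuous_lintegral_edist continuous_fst continuous_snd).comp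
        (continuous_apply i)) (fun _ _ h => mul_le_mul_right h _)
  obtain ⟨γ, hγ, hmin⟩ := LowerSemicontinuousOn.exists_isMinOn ⟨γ₀, hmem ρ₀ γ₀ hγ₀ hC₀⟩
    (hB.inter_right hS) (hlsc.lowerSemicontinuousOn _)
  have hplan : ∀ i, γ i ∈ transportPlans (ν i).1 (sndP (γ i₀)) := fun i =>
    ⟨congrArg ProbabilityMeasure.toMeasure (hγ.2 i).1,
      congrArg ProbabilityMeasure.toMeasure (hγ.2 i).2⟩
  have hmom : ∫⁻ x, edist a x ∂(sndP (γ i₀) : Measure X) < ∞ := by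
    rw [← lintegral_snd_of_mem_transportPlans (hplan i₀) (f := fun y => edist a y) (by fun_prop)]
    refine lt_of_le_of_lt (lintegral_mono fun p => ?_)
      ((hγ.1 i₀ trivial : ∫⁻ p, edist (a, a) p ∂(γ i₀ : Measure (X × X)) ≤ C).trans_lt hC.lt_top)
    exact le_max_right _ _
  refine ⟨P1.ofLintegral (sndP (γ i₀)) a hmom, fun ρ γ' hγ' hγ'C => ?_⟩
  refine le_trans (Finset.sum_le_sum fun i _ => ?_) (hmin (hmem ρ γ' hγ' hγ'C))
  gcongr
  exact transportCost_le (hplan i)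

theorem Med_nonempty {w : Fin N → ℝ} (hw : w ∈ stdSimplex ℝ (Fin N)) (ν : Fin N → P1 X) :
    (Med w ν).Nonempty := by
  obtain ⟨i₀, hi₀⟩ : ∃ i, 0 < w i := by
    by_contra! h
    have := Finset.sum_nonpos fun i (_ : i ∈ Finset.univ) => h i
    linarith [hw.2]
  obtain ⟨a⟩ := (ν i₀).1.nonempty
  let ρ₀ : P1 X := ν i₀
  let m : ProbabilityMeasure X → ℝ≥0∞ := fun μ => ∫⁻ x, edist a x ∂(μ : Measure X)
  -- The last two terms bound the moment of every `ρ` at least as good as `ρ₀`, since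
  -- `w i₀ * W1 (ν i₀) ρ` is a summand of its dispersion.
  let C : ℝ≥0∞ := ∑ i, m (ν i).1 +
    (m (ν i₀).1 + ENNReal.ofReal (dispersion w ν ρ₀ / w i₀))
  have hC : C ≠ ∞ := by
    refine ENNReal.add_ne_top.2 ⟨ENNReal.sum_ne_top.2 fun i _ => (lintegral_edist_lt_top _ _).ne,
      ENNReal.add_ne_top.2 ⟨(lintegral_edist_lt_top _ _).ne, ENNReal.ofReal_ne_top⟩⟩
  have hbound : ∀ ρ : P1 X, dispersion w ν ρ ≤ dispersion w ν ρ₀ →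
      ∀ (i : Fin N), ∀ γ ∈ transportPlans (ν i).1 ρ.1,
        ∫⁻ p, edist (a, a) p ∂(γ : Measure (X × X)) ≤ C := by
    intro ρ hρ i γ hγ
    have h1 : W1 (ν i₀) ρ ≤ dispersion w ν ρ₀ / w i₀ := by
      rw [le_div_iff₀' hi₀]
      exact (Finset.single_le_sum (f := fun i => w i * W1 (ν i) ρ)
        (fun i _ => mul_nonneg (hw.1 i) (W1_nonneg _ _)) (Finset.mem_univ i₀)).trans hρ
    calc ∫⁻ p, edist (a, a) p ∂(γ : Measure (X × X))
        ≤ ∫⁻ p : X × X, (edist a p.1 + edist a p.2) ∂(γ : Measure (X × X)) :=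
          lintegral_mono fun p => max_le le_self_add le_add_self
      _ = m (ν i).1 + m ρ.1 := by
          rw [lintegral_add_left (by fun_prop),
            lintegral_fst_of_mem_transportPlans hγ (f := fun y => edist a y) (by fun_prop),
            lintegral_snd_of_mem_transportPlans hγ (f := fun y => edist a y) (by fun_prop)]
      _ ≤ C := by
          refine add_le_add (Finset.single_le_sum (f := fun i => m (ν i).1) (fun _ _ => zero_le)
            (Finset.mem_univ i)) ?_
          refine (lintegral_edist_le_add_transportCost a (ν i₀).1 ρ.1).trans ?_
          rw [← ofReal_W1]
          gcongr
  have hprod : ∀ i, (ν i).1.prod ρ₀.1 ∈ transportPlans (ν i).1 ρ₀.1 := fun i => by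
    constructor <;> simp
  obtain ⟨μ, hμ⟩ := exists_minimal_plans w ν a hC i₀ hprod
    fun i => hbound ρ₀ le_rfl i _ (hprod i)
  have hgood : ∀ ρ : P1 X, dispersion w ν ρ ≤ dispersion w ν ρ₀ →
      dispersion w ν μ ≤ dispersion w ν ρ := by
    intro ρ hρ
    refine le_of_forall_pos_le_add fun ε hε => ?_
    have hex : ∀ i, ∃ γ ∈ transportPlans (ν i).1 ρ.1,
        ∫⁻ p : X × X, edist p.1 p.2 ∂(γ : Measure (X × X)) <
          transportCost (ν i).1 ρ.1 + ENNReal.ofReal ε := fun i =>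
      exists_mem_transportPlans_lintegral_lt
        (ENNReal.lt_add_right (transportCost_lt_top _ _).ne (by simpa using hε))
    choose γ hγ hγε using hex
    have h := hμ ρ.1 γ hγ fun i => hbound ρ hρ i _ (hγ i)
    have hnn : ∀ ρ : P1 X, 0 ≤ dispersion w ν ρ := fun ρ =>
      Finset.sum_nonneg fun i _ => mul_nonneg (hw.1 i) (W1_nonneg _ _)
    rw [← ENNReal.ofReal_le_ofReal_iff (add_nonneg (hnn ρ) hε.le),
      ENNReal.ofReal_add (hnn ρ) hε.le, ofReal_dispersion hw.1, ofReal_dispersion hw.1]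
    refine h.trans ?_
    calc ∑ i, ENNReal.ofReal (w i) * ∫⁻ p : X × X, edist p.1 p.2 ∂(γ i : Measure (X × X))
        ≤ ∑ i, ENNReal.ofReal (w i) * (transportCost (ν i).1 ρ.1 + ENNReal.ofReal ε) := by
          gcongr with i
          exact (hγε i).le
      _ = _ := by
          rw [← one_mul (ENNReal.ofReal ε), ← ENNReal.ofReal_one, ← hw.2,
            ENNReal.ofReal_sum_of_nonneg fun i _ => hw.1 i, Finset.sum_mul,
            ← Finset.sum_add_distrib]
          simp only [mul_add, ← Finset.sum_mul, ← ENNReal.ofReal_sum_of_nonneg fun i _ => hw.1 i,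
            hw.2, ENNReal.ofReal_one, one_mul]
  refine ⟨μ, fun ρ => ?_⟩
  rcases le_total (dispersion w ν ρ) (dispersion w ν ρ₀) with h | h
  · exact hgood ρ h
  · exact (hgood ρ₀ le_rfl).trans h

end Existence

section Breakdown

/-! ### Break-down of medians -/

variable {X : Type*} [MetricSpace X] [ProperSpace X] [MeasurableSpace X] [BorelSpace X] {N : ℕ}

/-- A median `m` of a corrupted sample `ν'` stays close to any measure `ρ` that is close to the
original sample; the bound has content when the corrupted weight is below one half. -/
theorem one_sub_two_mul_W1_le {w : Fin N → ℝ} (hw : w ∈ stdSimplex ℝ (Fin N))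
    {ν ν' : Fin N → P1 X} {I : Finset (Fin N)} (hν' : ∀ j, j ∉ I → ν' j = ν j) {m : P1 X}
    (hm : m ∈ Med w ν') (ρ : P1 X) :
    (1 - 2 * ∑ i ∈ I, w i) * W1 m ρ ≤ 2 * dispersion w ν ρ := by
  have hle : ∀ i, w i * W1 m ρ - (if i ∈ I then 2 * w i * W1 m ρ else 0) ≤
      2 * (w i * W1 (ν i) ρ) + (w i * W1 (ν' i) m - w i * W1 (ν' i) ρ) := by
    intro i
    have hwi := hw.1 i
    have hnn := mul_nonneg hwi (W1_nonneg (ν i) ρ)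
    split_ifs with hi
    · have := mul_le_mul_of_nonneg_left (W1_triangle (ν' i) m ρ) hwi
      linarith
    · rw [hν' i hi]
      have := mul_le_mul_of_nonneg_left (W1_triangle m (ν i) ρ) hwi
      rw [W1_comm m (ν i)] at this
      linarith
  have hsum := Finset.sum_le_sum fun i (_ : i ∈ Finset.univ) => hle i
  rw [Finset.sum_sub_distrib, Finset.sum_add_distrib, Finset.sum_sub_distrib, ← Finset.sum_mul,
    hw.2, ← Finset.sum_filter, Finset.filter_mem_eq_inter, Finset.univ_inter, ← Finset.sum_mul,
    ← Finset.mul_sum, ← Finset.mul_sum] at hsum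
  have hmin := hm ρ
  simp only [dispersion] at hmin ⊢
  linarith

/-- A point at which at least half of the weight is concentrated is a median. -/
theorem mem_Med_of_half_le {w : Fin N → ℝ} (hw : w ∈ stdSimplex ℝ (Fin N))
    {ν : Fin N → P1 X} {I : Finset (Fin N)} (hI : 1 / 2 ≤ ∑ i ∈ I, w i) {x : X}
    (hν : ∀ i ∈ I, ν i = P1.dirac x) : P1.dirac x ∈ Med w ν := by
  intro ρ
  set δ := P1.dirac x
  have hδ : W1 δ δ = 0 := by simp [δ, W1_dirac_dirac]
  have hle : ∀ i, (if i ∈ I then 2 * w i * W1 δ ρ else 0) - w i * W1 δ ρ ≤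
      w i * W1 (ν i) ρ - w i * W1 (ν i) δ := by
    intro i
    have hwi := hw.1 i
    split_ifs with hi
    · rw [hν i hi, hδ]
      linarith
    · have := mul_le_mul_of_nonneg_left (W1_triangle (ν i) ρ δ) hwi
      rw [W1_comm ρ δ] at this
      linarith
  have hsum := Finset.sum_le_sum fun i (_ : i ∈ Finset.univ) => hle i
  rw [Finset.sum_sub_distrib, Finset.sum_sub_distrib, ← Finset.sum_mul,
    hw.2, ← Finset.sum_filter, Finset.filter_mem_eq_inter, Finset.univ_inter, ← Finset.sum_mul,
    ← Finset.mul_sum] at hsum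
  have := mul_nonneg (by linarith : 0 ≤ 2 * ∑ i ∈ I, w i - 1) (W1_nonneg δ ρ)
  simp only [dispersion]
  linarith

theorem maxDisplacement_Med_eq_top_iff (hX : ¬ Bornology.IsBounded (Set.univ : Set X))
    {w : Fin N → ℝ} (hw : w ∈ stdSimplex ℝ (Fin N)) (ν : Fin N → P1 X) (I : Finset (Fin N)) :
    maxDisplacement (Med w) ν I = ⊤ ↔ 1 / 2 ≤ ∑ i ∈ I, w i := by
  classical
  obtain ⟨ρ, hρ⟩ := Med_nonempty hw ν
  constructor
  · intro htop
    by_contra! hI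
    have hpos : 0 < 1 - 2 * ∑ i ∈ I, w i := by linarith
    have hub : maxDisplacement (Med w) ν I ≤
        ((2 * dispersion w ν ρ / (1 - 2 * ∑ i ∈ I, w i) : ℝ) : EReal) := by
      refine sSup_le ?_
      rintro r ⟨ν', hν', m, hm, ρ', hρ', rfl⟩
      rw [EReal.coe_le_coe_iff, le_div_iff₀' hpos]
      refine (one_sub_two_mul_W1_le hw hν' hm ρ').trans ?_
      have := hρ' ρ
      linarith
    rw [htop, top_le_iff] at hub
    exact EReal.coe_ne_top _ hub
  · intro hI
    obtain ⟨a⟩ := ρ.1.nonempty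
    refine (EReal.eq_top_iff_forall_lt _).2 fun R => ?_
    obtain ⟨x, hx⟩ : ∃ x, R + W1 (P1.dirac a) ρ < dist x a := by
      by_contra! h
      exact hX (Metric.isBounded_closedBall.subset fun x _ => h x)
    have hmem := mem_Med_of_half_le hw hI (x := x)
      (ν := fun i => if i ∈ I then P1.dirac x else ν i) fun i hi => if_pos hi
    have htri := W1_triangle (P1.dirac x) ρ (P1.dirac a)
    rw [W1_dirac_dirac, W1_comm ρ] at htri
    refine lt_of_lt_of_le (b := ((W1 (P1.dirac x) ρ : ℝ) : EReal)) ?_ (le_sSup ?_)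
    · rw [EReal.coe_lt_coe_iff]
      linarith
    · exact ⟨_, fun j hj => if_neg hj, _, hmem, ρ, hρ, rfl⟩

theorem isLeast_card_div_of_half_le (hN : N ≠ 0) {w : Fin N → ℝ} (hw : ∀ i, w i = 1 / (N : ℝ)) :
    IsLeast {r : ℝ | ∃ J : Finset (Fin N), 1 / 2 ≤ ∑ j ∈ J, w j ∧ r = ∑ j ∈ J, w j}
      ((⌊((N : ℝ) + 1) / 2⌋ : ℝ) / (N : ℝ)) := by
  have hN' : (0 : ℝ) < N := by positivity
  have hfloor : ⌊((N : ℝ) + 1) / 2⌋ = (((N + 1) / 2 : ℕ) : ℤ) := by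
    rw [Int.floor_eq_iff]
    have h1 : 2 * ((N + 1) / 2) ≤ N + 1 := by omega
    have h2 : N + 1 < 2 * ((N + 1) / 2) + 2 := by omega
    have h1' : (2 * ((N + 1) / 2 : ℕ) : ℝ) ≤ N + 1 := by exact_mod_cast h1
    have h2' : (N + 1 : ℝ) < 2 * ((N + 1) / 2 : ℕ) + 2 := by exact_mod_cast h2
    rw [Int.cast_natCast]
    constructor <;> linarith
  have hsum : ∀ J : Finset (Fin N), ∑ j ∈ J, w j = (J.card : ℝ) / N := by
    intro J
    simp [hw, div_eq_mul_inv]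
  have hhalf : ∀ k : ℕ, 1 / 2 ≤ (k : ℝ) / N ↔ (N + 1) / 2 ≤ k := by
    intro k
    rw [le_div_iff₀ hN', show (1 / 2 * (N : ℝ) ≤ k ↔ (N : ℝ) ≤ 2 * k) by
      constructor <;> intro h <;> linarith]
    norm_cast
    omega
  rw [hfloor, Int.cast_natCast]
  simp only [hsum, hhalf]
  constructor
  · obtain ⟨J, -, hJ⟩ := Finset.exists_subset_card_eq
      (s := (Finset.univ : Finset (Fin N))) (n := (N + 1) / 2) (by simp; omega)
    exact ⟨J, hJ.ge, by rw [hJ]⟩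
  · rintro r ⟨J, hJ, rfl⟩
    gcongr

end Breakdown

end WassersteinMedian

theorem mainTheorem1 {X : Type*} [MetricSpace X] [ProperSpace X] [MeasurableSpace X]
    [BorelSpace X] (hX : ¬ Bornology.IsBounded (Set.univ : Set X))
    (N : ℕ) (hN : 2 ≤ N) (w : Fin N → ℝ) (hw : w ∈ stdSimplex ℝ (Fin N))
    (ν : Fin N → WassersteinMedian.P1 X) :
    -- the estimator has nonempty values
    (∀ μ : Fin N → WassersteinMedian.P1 X, (WassersteinMedian.Med w μ).Nonempty) ∧
    -- the minimum that defines the break-down point is attained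
    IsLeast (WassersteinMedian.breakdownWeights w (WassersteinMedian.Med w) ν)
      (WassersteinMedian.breakdownPoint w (WassersteinMedian.Med w) ν) ∧
    -- its value is the least total weight that is at least one half
    IsLeast {r : ℝ | ∃ J : Finset (Fin N), 1 / 2 ≤ ∑ j ∈ J, w j ∧ r = ∑ j ∈ J, w j}
      (WassersteinMedian.breakdownPoint w (WassersteinMedian.Med w) ν) ∧
    -- the case of uniform weights
    ((∀ i, w i = 1 / (N : ℝ)) →
      WassersteinMedian.breakdownPoint w (WassersteinMedian.Med w) ν =
        (⌊((N : ℝ) + 1) / 2⌋ : ℝ) / (N : ℝ)) := by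

  classical
  have hset : WassersteinMedian.breakdownWeights w (WassersteinMedian.Med w) ν =
      {r : ℝ | ∃ J : Finset (Fin N), 1 / 2 ≤ ∑ j ∈ J, w j ∧ r = ∑ j ∈ J, w j} := by
    simp only [WassersteinMedian.breakdownWeights,
      WassersteinMedian.maxDisplacement_Med_eq_top_iff hX hw]
  have hfin : (WassersteinMedian.breakdownWeights w (WassersteinMedian.Med w) ν).Finite := by
    refine (Set.finite_range fun I : Finset (Fin N) => ∑ i ∈ I, w i).subset ?_
    rintro r ⟨I, -, rfl⟩
    exact ⟨I, rfl⟩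
  have hne : (WassersteinMedian.breakdownWeights w (WassersteinMedian.Med w) ν).Nonempty := by
    rw [hset]
    refine ⟨_, Finset.univ, ?_, rfl⟩
    rw [hw.2]
    norm_num
  have hleast : IsLeast (WassersteinMedian.breakdownWeights w (WassersteinMedian.Med w) ν)
      (WassersteinMedian.breakdownPoint w (WassersteinMedian.Med w) ν) :=
    ⟨hne.csInf_mem hfin, fun r hr => csInf_le hfin.bddBelow hr⟩
  refine ⟨fun μ => WassersteinMedian.Med_nonempty hw μ, hleast, hset ▸ hleast, fun hunif => ?_⟩
  rw [hset] at hleast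
  exact hleast.unique (WassersteinMedian.isLeast_card_div_of_half_le (by omega) hunif)
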